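/- Let $q$ be a prime power and let $m,l,k$ be positive integers with $3\le k\le\min\{m+1,l\}$. A $q$-PBD$(v,K,\lambda)$ (also called a $2$-$(v,K,\lambda)_q$ design) is a collection, possibly with repetitions, of subspaces (blocks) of a $v$-dimensional vector space over $\mathrm{GF}(q)$ whose dimensions belong to $K$, such that every $2$-dimensional subspace is contained in exactly $\lambda$ blocks, counted with multiplicity; it is simple if no block is repeated. It admits a subgroup $G\le\mathrm{GL}(v,q)$ as an automorphism group if every $g\in G$ maps the collection of blocks to itself, with multiplicities. A Singer cycle $H$ of $\mathrm{GF}(q)^l\cong\mathrm{GF}(q^l)$ is the cyclic group generated by the multiplication by a primitive element of $\mathrm{GF}(q^l)$, and $n_{d,u}^l$ denotes the number of $H$-orbits on the $d$-dimensional subspaces of $\mathrm{GF}(q)^l$ whose stabilizer in $H$ is isomorphic to $\mathrm{GF}(q^u)^*$. Regard $\mathrm{GF}(q)^{ml}$ as an $m$-dimensional vector space over $\mathrm{GF}(q^l)$, so that $\mathrm{GL}(m,q^l)\le\mathrm{GL}(ml,q)$. Let $w\in\{0,1\}$, let $w_{r,u}$ be integers with $0\le w_{r,u}\le n_{r+1,u}^l$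 for $2\le r\le k-1$ and $u\mid\gcd(r+1,l)$, and let $$\lambda=\sum_{r=2}^{k-1}\ \sum_{u\mid\gcd(r+1,l)} w_{r,u}\,\frac{(q^k-1)(q^k-q)\prod_{j=2}^{k-2}(q^{ml}-q^{jl})}{(q^u-1)\prod_{j=r+1}^{k-1}(q^k-q^j)}+w\,q^{(l-1)\left(\binom k2-1\right)}\prod_{j=2}^{k-1}\frac{q^{(m-j)l}-1}{q^{k-j}-1}.$$ If there exists a $q$-PBD$(l,K,\lambda)$ admitting a Singer cycle $H$ as an automorphism group, then there exists a $q$-PBD$(ml,K\cup\{k\},\lambda)$ admitting $\mathrm{GL}(m,q^l)$ as an automorphism group. If the original $q$-PBD is simple, then the resulting $q$-PBD can be taken simple as well. -/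

import Mathlib

namespace QDesign

open Module
open scoped Pointwise

section Designs

variable {F : Type*} [Field F] {V : Type*} [AddCommGroup V] [Module F V]

open Classical in
/-- The collection (multiset) `B` of subspaces is the block collection of a `t`-`(v, K, lam)_q`
design on the `v`-dimensional space `V`: block dimensions lie in `K`, and every `t`-subspace lies in
exactly `lam` blocks, counted with multiplicity. -/
structure IsDesign (t v : ℕ) (K : Set ℕ) (lam : ℕ) (B : Multiset (Submodule F V)) : Prop where
  finrank_eq : finrank F V = v
  finrank_mem : ∀ W ∈ B, finrank F W ∈ K
  balanced : ∀ T : Submodule F V, finrank F T = t → B.countP (fun W => T ≤ W) = lam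

/-- A `q`-analog of a pairwise balanced design, `q`-PBD`(v, K, lam)`. -/
abbrev IsPBD (v : ℕ) (K : Set ℕ) (lam : ℕ) (B : Multiset (Submodule F V)) : Prop :=
  IsDesign 2 v K lam B

/-- A design is simple if it has no repeated blocks. -/
def IsSimple (B : Multiset (Submodule F V)) : Prop := B.Nodup

/-- `G ≤ GL(V)` is an automorphism group of the block collection `B`: each `g ∈ G` maps `B` to
itself, with multiplicities. Here `g • W` is the image `g(W)`. -/
def IsAutomorphismGroup (G : Subgroup (V ≃ₗ[F] V)) (B : Multiset (Submodule F V)) : Prop :=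
  ∀ g ∈ G, B.map (fun W => g • W) = B

/-- The number of `H`-orbits on the `d`-subspaces of `V` whose stabilizers in `H` are isomorphic to
the multiplicative group of a field with `q ^ u` elements, where `q = |F|`. For `H` a Singer cycle of
a `v`-dimensional space this is `n_{d,u}^v`. -/
noncomputable def orbitCount (H : Subgroup (V ≃ₗ[F] V)) (d u : ℕ) : ℕ :=
  Set.ncard {O : Set (Submodule F V) | ∃ W : Submodule F V, finrank F W = d ∧
    (∃ (E : Type) (_ : Field E), Nat.card E = Nat.card F ^ u ∧
      Nonempty (MulAction.stabilizer H W ≃* Eˣ)) ∧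
    O = MulAction.orbit H W}

end Designs

/-- `H ≤ GL(U)` is a Singer cycle: under some `F`-linear identification `φ` of `U` with the extension
field `L` it is generated by multiplication by a primitive element (a generator `w` of `Lˣ`). -/
def IsSingerCycle {F : Type*} [Field F] (L : Type*) [Field L] [Algebra F L]
    {U : Type*} [AddCommGroup U] [Module F U] (H : Subgroup (U ≃ₗ[F] U)) : Prop :=
  ∃ (φ : U ≃ₗ[F] L) (w : Lˣ) (T : U ≃ₗ[F] U),
    (∀ z : Lˣ, z ∈ Subgroup.zpowers w) ∧ (∀ x : U, φ (T x) = (w : L) * φ x) ∧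
      H = Subgroup.zpowers T

/-- The group of `L`-linear automorphisms of `V`, as a subgroup of the group of `F`-linear ones.
When `L` has `q ^ l` elements and `dim_L V = m`, this is `GL(m, q ^ l) ≤ GL(ml, q)`. -/
def extGL (F L V : Type*) [Field F] [Field L] [Algebra F L] [AddCommGroup V] [Module F V]
    [Module L V] : Subgroup (V ≃ₗ[F] V) where
  carrier := {g | ∀ (c : L) (x : V), g (c • x) = c • g x}
  mul_mem' := by
    intro a b ha hb c x
    change a (b (c • x)) = c • a (b x)
    rw [hb, ha]
  one_mem' := fun _ _ => rfl
  inv_mem' := by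
    intro a ha c x
    change a.symm (c • x) = c • a.symm x
    apply a.injective
    rw [ha, a.apply_symm_apply, a.apply_symm_apply]

/-- The admissible index: the sum over `2 ≤ r ≤ k - 1` and `u ∣ gcd (r + 1, l)` of the terms
weighted by `w r u`, plus `w₀` times the last term. -/
def lambdaValue (q m l k : ℕ) (w : ℕ → ℕ → ℕ) (w₀ : ℕ) : ℚ :=
  (∑ r ∈ Finset.Icc 2 (k - 1), ∑ u ∈ (Nat.gcd (r + 1) l).divisors,
    (w r u : ℚ) *
      ((((q : ℚ) ^ k - 1) * ((q : ℚ) ^ k - q) *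
          ∏ j ∈ Finset.Icc 2 (k - 2), ((q : ℚ) ^ (m * l) - (q : ℚ) ^ (j * l))) /
        (((q : ℚ) ^ u - 1) * ∏ j ∈ Finset.Icc (r + 1) (k - 1), ((q : ℚ) ^ k - (q : ℚ) ^ j)))) +
  (w₀ : ℚ) * (q : ℚ) ^ ((l - 1) * (k.choose 2 - 1)) *
    ∏ j ∈ Finset.Icc 2 (k - 1), ((q : ℚ) ^ ((m - j) * l) - 1) / ((q : ℚ) ^ (k - j) - 1)

end QDesign

/-!
A `2`-subspace of `V` either lies on an `L`-line, or its bases are linearly independent over `L`.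
The two kinds are treated separately.

The Singer cycle is the full group `Lˣ` of multiplications (`IsSingerCycle.exists_eq_range`), so
the given design can be copied onto each `L`-line of `V` independently of the vector chosen on it
(`map_lineMap_smul`). These copies are permuted by `GL(V)` over `L` and cover every `2`-subspace
of the first kind exactly `lam` times, those of the second kind never.

For the second kind consider `k`-dimensional `F`-subspaces `W` of `V` whose `F`-independent pairs
are all `L`-independent. Since `GL(V)` over `L` is transitive on `L`-independent pairs, every
invariant collection of such `W` covers all `2`-subspaces of the second kind equally often. Such
collections come from the `L`-linear relations among an `F`-basis of `W`, a subspace of `L ^ k`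
that is determined up to `GL(k, F)`. Two sorts of relation spaces are used: the zero space, which
gives the last term of `lambdaValue`, and the lines `L ∙ a` for which the coordinates of `a` span
a given `F`-subspace `A` of `L`. If `dim A = r + 1 ≥ 3` then `W` has the required property, and
two subspaces `A` give the same or disjoint collections according to whether they are in one orbit
of `Lˣ`. With a stabilizer of order `q ^ u - 1` the collection contributes the term of
`lambdaValue` with indices `r` and `u`; choosing `w r u` orbits for all `r`, `u` makes the total
equal to `lam`.

All multiplicities are computed by double counting (`card_mul_eq_card_mul`), from the numbers of
linearly independent and of spanning families: `IsAdmissible.card_blocks_pair` passes from blocks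
to bases of blocks, and `card_frames_lineRelations` from bases to the vectors `a`.
-/

namespace QDesign

open Module
open scoped Pointwise

/-! ### Linearly independent and spanning families -/

/-- Double counting of the pairs related by `R`, when both kinds of fibres have constant size. -/
theorem card_mul_eq_card_mul {X Y : Type*} [Finite X] [Finite Y] (R : X → Y → Prop) {a b : ℚ}
    (ha : ∀ x, (Nat.card {y // R x y} : ℚ) = a) (hb : ∀ y, (Nat.card {x // R x y} : ℚ) = b) :
    Nat.card X * a = Nat.card Y * b := by
  have e : (Σ x, {y // R x y}) ≃ (Σ y, {x // R x y}) :=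
    { toFun := fun p => ⟨p.2.1, p.1, p.2.2⟩
      invFun := fun p => ⟨p.2.1, p.1, p.2.2⟩
      left_inv := fun _ => rfl
      right_inv := fun _ => rfl }
  have := Fintype.ofFinite X
  have := Fintype.ofFinite Y
  have h := congrArg (Nat.cast (R := ℚ)) (Nat.card_congr e)
  rw [Nat.card_sigma, Nat.card_sigma] at h
  simpa [ha, hb] using h

section Counting

variable {K : Type*} [Field K] {E : Type*} [AddCommGroup E] [Module K E]

/-- The coordinate columns of a spanning family are linearly independent, and conversely. -/
theorem span_range_eq_top_iff {k d : ℕ} (a : Fin k → Fin d → K) :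
    Submodule.span K (Set.range a) = ⊤ ↔ LinearIndependent K (fun j i => a i j) := by
  have h1 : (Matrix.of a).rank = finrank K (Submodule.span K (Set.range a)) :=
    Matrix.rank_eq_finrank_span_row (Matrix.of a)
  have h2 : (Matrix.of a).rank =
      finrank K (Submodule.span K (Set.range (fun (j : Fin d) (i : Fin k) => a i j))) :=
    Matrix.rank_eq_finrank_span_cols (Matrix.of a)
  rw [linearIndependent_iff_card_eq_finrank_span, Set.finrank, ← h2, h1, Fintype.card_fin]
  constructor
  · intro h
    rw [h, finrank_top, finrank_fin_fun]
  · intro h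
    apply Submodule.eq_top_of_finrank_eq
    rw [← h, finrank_fin_fun]

/-- Reading the coordinates in `A` of a spanning family column by column turns spanning families of
length `k` into independent families of length `dim A`. -/
theorem card_spanning_eq_card_linearIndependent {k d : ℕ} (A : Submodule K E)
    (e : (Fin d → K) ≃ₗ[K] A) :
    Nat.card {a : Fin k → E // Submodule.span K (Set.range a) = A} =
      Nat.card {s : Fin d → Fin k → K // LinearIndependent K s} := by
  let f : (Fin d → K) →ₗ[K] E := A.subtype ∘ₗ e.toLinearMap
  have hf : Function.Injective f := A.injective_subtype.comp e.injective
  have hfr : LinearMap.range f = A := by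
    rw [LinearMap.range_comp, LinearEquiv.range, Submodule.map_top, Submodule.range_subtype]
  have key : ∀ b : Fin k → Fin d → K, Submodule.span K (Set.range (fun i => f (b i))) = A ↔
      LinearIndependent K (fun j i => b i j) := by
    intro b
    rw [← span_range_eq_top_iff, show (fun i => f (b i)) = f ∘ b from rfl, Set.range_comp,
      ← Submodule.map_span]
    constructor
    · intro h
      apply Submodule.map_injective_of_injective hf
      rw [h, Submodule.map_top, hfr]
    · intro h
      rw [h, Submodule.map_top, hfr]
  symm
  refine Nat.card_congr (Equiv.ofBijective
    (fun s => ⟨fun i => f (fun j => s.1 j i), (key fun i j => s.1 j i).2 s.2⟩) ⟨?_, ?_⟩)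
  · intro s t h
    ext j i
    exact congrFun (hf (congrFun (Subtype.ext_iff.1 h) i)) j
  · rintro ⟨a, ha⟩
    have : ∀ i, ∃ b, f b = a i := fun i => by
      have : a i ∈ LinearMap.range f := by
        rw [hfr, ← ha]
        exact Submodule.subset_span ⟨i, rfl⟩
      exact this
    choose b hb using this
    have hb' : (fun i => f (b i)) = a := funext hb
    exact ⟨⟨fun j i => b i j, (key b).1 (hb'.symm ▸ ha)⟩, Subtype.ext hb'⟩

/-- In `ℚ` the product formula for the number of linearly independent families needs no bound on
their length: beyond the dimension the factor `j = dim E` vanishes. -/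
theorem card_linearIndependent_cast (K E : Type*) [Field K] [Finite K] [AddCommGroup E]
    [Module K E] [Finite E] (k : ℕ) :
    (Nat.card {s : Fin k → E // LinearIndependent K s} : ℚ) =
      ∏ j ∈ Finset.range k, ((Nat.card K : ℚ) ^ finrank K E - (Nat.card K : ℚ) ^ j) := by
  have := Fintype.ofFinite K
  rcases le_or_gt k (finrank K E) with h | h
  · rw [card_linearIndependent h, Nat.cast_prod, ← Fin.prod_univ_eq_prod_range
      (fun j => ((Nat.card K : ℚ) ^ finrank K E - (Nat.card K : ℚ) ^ j))]
    refine Finset.prod_congr rfl fun i _ => ?_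
    rw [Nat.cast_sub (Nat.pow_le_pow_right Fintype.card_pos (i.2.le.trans h)),
      Nat.card_eq_fintype_card]
    push_cast
    rfl
  · rw [Finset.prod_eq_zero (Finset.mem_range.2 h) (sub_self _), Nat.cast_eq_zero]
    have : IsEmpty {s : Fin k → E // LinearIndependent K s} := by
      refine ⟨fun s => ?_⟩
      have := s.2.fintype_card_le_finrank
      rw [Fintype.card_fin] at this
      omega
    exact Nat.card_of_isEmpty

variable [Finite K] [Finite E]

/-- The number of families of length `k` that span a given subspace. -/
theorem card_spanning (k : ℕ) (A : Submodule K E) :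
    (Nat.card {a : Fin k → E // Submodule.span K (Set.range a) = A} : ℚ) =
      ∏ j ∈ Finset.range (finrank K A), ((Nat.card K : ℚ) ^ k - (Nat.card K : ℚ) ^ j) := by
  rw [card_spanning_eq_card_linearIndependent A (finBasis K A).equivFun.symm,
    card_linearIndependent_cast, finrank_fin_fun]

/-- The number of bases, as ordered families, of a given subspace of dimension `k`. -/
theorem card_bases {k : ℕ} (W : Submodule K E) (hW : finrank K W = k) :
    (Nat.card {y : Fin k → E // LinearIndependent K y ∧ Submodule.span K (Set.range y) = W} : ℚ) =
      ∏ j ∈ Finset.range k, ((Nat.card K : ℚ) ^ k - (Nat.card K : ℚ) ^ j) := by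
  rw [← hW, ← card_spanning (finrank K W) W]
  congr 1
  refine Nat.card_congr (Equiv.subtypeEquivRight fun y => ⟨fun h => h.2, fun h => ⟨?_, h⟩⟩)
  rw [linearIndependent_iff_card_eq_finrank_span, Set.finrank, h, Fintype.card_fin]

end Counting

/-! ### Subspaces with prescribed relations -/

section Relations

variable (L : Type*) [Field L] {V : Type*} [AddCommGroup V] [Module L V] {k : ℕ}

/-- The space of `L`-linear relations satisfied by the family `x`. -/
def relations (x : Fin k → V) : Submodule L (Fin k → L) :=
  LinearMap.ker (Fintype.linearCombination L x)

theorem mem_relations {x : Fin k → V} {c : Fin k → L} :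
    c ∈ relations L x ↔ ∑ i, c i • x i = 0 := by
  rw [relations, LinearMap.mem_ker, Fintype.linearCombination_apply]

theorem relations_comp {g : V ≃ₗ[L] V} (x : Fin k → V) :
    relations L (fun i => g (x i)) = relations L x := by
  ext c
  simp only [mem_relations, ← map_smul, ← map_sum, LinearEquiv.map_eq_zero_iff]

/-- Families with a prescribed space `N` of relations are the linearly independent families
indexed by a basis of `L ^ k / N`. -/
theorem card_relations_eq [Finite L] [Finite V] (N : Submodule L (Fin k → L)) :
    (Nat.card {x : Fin k → V // relations L x = N} : ℚ) =
      ∏ j ∈ Finset.range (k - finrank L N),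
        ((Nat.card L : ℚ) ^ finrank L V - (Nat.card L : ℚ) ^ j) := by
  rw [← card_linearIndependent_cast]
  congr 1
  symm
  have hd : finrank L ((Fin k → L) ⧸ N) = k - finrank L N := by
    rw [Submodule.finrank_quotient, finrank_fin_fun]
  let b := finBasisOfFinrankEq L _ hd
  let f : (Fin (k - finrank L N) → V) → (Fin k → L) →ₗ[L] V :=
    fun s => (b.constr L s) ∘ₗ N.mkQ
  have hf : ∀ s, Fintype.linearCombination L (fun i => f s (Pi.single i 1)) = f s := by
    intro s
    refine LinearMap.pi_ext' fun i => LinearMap.ext_ring ?_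
    simp [Fintype.linearCombination_apply_single]
  have hinj : ∀ s : Fin (k - finrank L N) → V,
      LinearIndependent L s ↔ Function.Injective (b.constr L s) := by
    intro s
    rw [← LinearMap.ker_eq_bot]
    constructor
    · intro h
      apply LinearMap.ker_eq_bot.2
      intro p p' hp
      apply b.repr.injective
      apply h
      rwa [Finsupp.linearCombination_apply, Finsupp.linearCombination_apply,
        ← Basis.constr_apply (S := L), ← Basis.constr_apply (S := L)]
    · intro h
      have := b.linearIndependent.map' (b.constr L s) h
      rwa [show (b.constr L s) ∘ b = s from funext fun i => b.constr_basis L s i] at this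
  have hker : ∀ s : Fin (k - finrank L N) → V, LinearIndependent L s ↔
      relations L (fun i => f s (Pi.single i 1)) = N := by
    intro s
    rw [relations, hf, hinj, ← LinearMap.ker_eq_bot, LinearMap.ker_comp]
    constructor
    · intro h
      rw [h, Submodule.comap_bot, Submodule.ker_mkQ]
    · intro h
      apply Submodule.comap_injective_of_surjective N.mkQ_surjective
      rw [h, Submodule.comap_bot, Submodule.ker_mkQ]
  refine Nat.card_congr (Equiv.ofBijective
    (fun s => ⟨fun i => f s.1 (Pi.single i 1), (hker s.1).1 s.2⟩) ⟨?_, ?_⟩)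
  · intro s t h
    have h1 : f s.1 = f t.1 := by
      rw [← hf s.1, ← hf t.1]
      exact congrArg (Fintype.linearCombination L) (Subtype.ext_iff.1 h)
    have h2 : b.constr L s.1 = b.constr L t.1 :=
      LinearMap.ext fun p => by
        obtain ⟨c, rfl⟩ := N.mkQ_surjective p
        exact LinearMap.congr_fun h1 c
    exact Subtype.ext ((b.constr L).injective h2)
  · rintro ⟨x, hx⟩
    let g := N.liftQ (Fintype.linearCombination L x) hx.ge
    have hg : f (fun j => g (b j)) = Fintype.linearCombination L x := by
      have : b.constr L (fun j => g (b j)) = g := b.ext fun j => b.constr_basis L _ j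
      simp only [f, this]
      exact Submodule.liftQ_mkQ _ _ _
    have hx' : (fun i => f (fun j => g (b j)) (Pi.single i 1)) = x := by
      rw [hg]
      funext i
      simp [Fintype.linearCombination_apply_single]
    exact ⟨⟨fun j => g (b j), (hker _).2 (by rw [hx', hx])⟩, Subtype.ext hx'⟩

end Relations

section Frames

variable (F L : Type*) [Field F] [Field L] [Algebra F L] {k : ℕ}

/-- A family `N` of subspaces of `L ^ k` that can be prescribed as relation spaces of bases of a
class of `k`-dimensional `F`-subspaces: the family is invariant under the substitutions of
`GL(k, F)`, and no subspace in it has a nonzero vector whose coordinates span at most two dimensions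
over `F`. The last condition says that `F`-independent pairs remain independent over `L`. -/
structure IsAdmissible (N : Set (Submodule L (Fin k → L))) : Prop where
  eq_zero : ∀ R ∈ N, ∀ c ∈ R, finrank F (Submodule.span F (Set.range c)) ≤ 2 → c = 0
  substitution : ∀ R ∈ N, ∀ M M' : Matrix (Fin k) (Fin k) F, M * M' = 1 → ∀ R',
    (∀ c, c ∈ R' ↔ Matrix.vecMul c (M.map (algebraMap F L)) ∈ R) → R' ∈ N

variable {L} (V : Type*) [AddCommGroup V] [Module F V] [Module L V]

/-- The families of vectors whose space of relations belongs to `N`. -/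
def frames (N : Set (Submodule L (Fin k → L))) : Set (Fin k → V) := {x | relations L x ∈ N}

/-- The `F`-subspaces spanned by families whose space of relations belongs to `N`. -/
def blocks (N : Set (Submodule L (Fin k → L))) : Set (Submodule F V) :=
  {W | ∃ x ∈ frames V N, Submodule.span F (Set.range x) = W}

variable {F V} [IsScalarTower F L V] {N : Set (Submodule L (Fin k → L))}

theorem finrank_span_le_one {e : L} {p : Fin k → F} :
    finrank F (Submodule.span F (Set.range fun i => p i • e)) ≤ 1 := by
  have h : Submodule.span F (Set.range fun i => p i • e) ≤ Submodule.span F {e} := by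
    rw [Submodule.span_le]
    rintro _ ⟨i, rfl⟩
    exact Submodule.smul_mem _ _ (Submodule.mem_span_singleton_self e)
  exact (Submodule.finrank_mono h).trans ((finrank_span_le_card _).trans (by simp))

theorem finrank_span_le_two {s t : L} {p p' : Fin k → F} :
    finrank F (Submodule.span F (Set.range fun i => p i • s + p' i • t)) ≤ 2 := by
  classical
  have h : Submodule.span F (Set.range fun i => p i • s + p' i • t) ≤ Submodule.span F {s, t} := by
    rw [Submodule.span_le]
    rintro _ ⟨i, rfl⟩
    exact Submodule.add_mem _
      (Submodule.smul_mem _ _ (Submodule.subset_span (Set.mem_insert _ _)))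
      (Submodule.smul_mem _ _ (Submodule.subset_span (Set.mem_insert_of_mem _ rfl)))
  have hcard : finrank F (Submodule.span F {s, t}) ≤ 2 := by
    have := finrank_span_finset_le_card (R := F) ({s, t} : Finset L)
    rw [Finset.coe_pair] at this
    exact this.trans Finset.card_le_two
  have : Module.Finite F (Submodule.span F {s, t}) :=
    FiniteDimensional.span_of_finite F (by simp)
  exact (Submodule.finrank_mono h).trans hcard

theorem IsAdmissible.linearIndependent (hN : IsAdmissible F L N) {x : Fin k → V}
    (hx : x ∈ frames V N) : LinearIndependent F x := by
  rw [Fintype.linearIndependent_iff]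
  intro p hp
  have h0 : (fun i => p i • (1 : L)) = 0 := by
    refine hN.eq_zero _ hx _ ((mem_relations L).2 ?_) (finrank_span_le_one.trans one_le_two)
    simpa using hp
  intro i
  simpa [Algebra.smul_def] using congrFun h0 i

theorem IsAdmissible.finrank_eq (hN : IsAdmissible F L N) {W : Submodule F V}
    (hW : W ∈ blocks F V N) : finrank F W = k := by
  obtain ⟨x, hx, rfl⟩ := hW
  rw [finrank_span_eq_card (hN.linearIndependent hx), Fintype.card_fin]

/-- Coordinates of an `F`-independent pair stay independent when scalars are extended to `L`. -/
theorem eq_zero_of_smul_add_smul_eq_zero {p p' : Fin k → F} (h : LinearIndependent F ![p, p'])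
    {s t : L} (hst : ∀ i, p i • s + p' i • t = 0) : s = 0 ∧ t = 0 := by
  obtain ⟨f, hf⟩ : ∃ f : (Fin k → F) →ₗ[F] (Fin 2 → F),
      f ∘ ![p, p'] = fun j => Pi.single j 1 := by
    obtain ⟨f, hf⟩ := LinearMap.exists_leftInverse_of_injective
      (Fintype.linearCombination F ![p, p']) (LinearMap.ker_eq_bot.2
        (linearIndependent_iff_injective_fintypeLinearCombination.1 h))
    refine ⟨f, funext fun j => ?_⟩
    have := LinearMap.congr_fun hf (Pi.single j 1)
    simpa [Fintype.linearCombination_apply_single] using this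
  have key : ∀ v j, f v j = ∑ i, v i * f (Pi.single i 1) j := by
    intro v j
    conv_lhs => rw [pi_eq_sum_univ' v, map_sum]
    simp
  have hfp : ∀ j, (f p j) • s + (f p' j) • t = 0 := by
    intro j
    rw [key p, key p', Finset.sum_smul, Finset.sum_smul, ← Finset.sum_add_distrib]
    refine Finset.sum_eq_zero fun i _ => ?_
    rw [mul_comm, mul_smul, mul_comm, mul_smul, ← smul_add, hst, smul_zero]
  have e0 : f p = Pi.single 0 1 := congrFun hf 0
  have e1 : f p' = Pi.single 1 1 := congrFun hf 1
  have h0 := hfp 0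
  have h1 := hfp 1
  rw [e0, e1] at h0 h1
  simp at h0 h1
  exact ⟨h0, h1⟩

/-- A relation between two vectors of a block, written in a frame, is a relation of the frame whose
coordinates span at most two dimensions over `F`, so it vanishes. -/
theorem IsAdmissible.linearIndependent_pair (hN : IsAdmissible F L N) {W : Submodule F V}
    (hW : W ∈ blocks F V N) {y : Fin 2 → V} (hy : LinearIndependent F y) (hyW : ∀ i, y i ∈ W) :
    LinearIndependent L y := by
  obtain ⟨x, hx, rfl⟩ := hW
  have hp : ∀ j, ∃ p : Fin k → F, ∑ i, p i • x i = y j := fun j =>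
    (Submodule.mem_span_range_iff_exists_fun F).1 (hyW j)
  choose p hp using hp
  have hpli : LinearIndependent F ![p 0, p 1] := by
    rw [show ![p 0, p 1] = p by funext j; fin_cases j <;> rfl]
    refine LinearIndependent.of_comp (Fintype.linearCombination F x) ?_
    rwa [show (Fintype.linearCombination F x) ∘ p = y from
      funext fun j => by rw [Function.comp_apply, Fintype.linearCombination_apply, hp]]
  have hy2 : y = ![y 0, y 1] := by funext j; fin_cases j <;> rfl
  rw [hy2, LinearIndependent.pair_iff]
  intro s t hst
  refine eq_zero_of_smul_add_smul_eq_zero hpli (congrFun (hN.eq_zero _ hx _ ?_ finrank_span_le_two))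
  rw [mem_relations]
  rw [← hp 0, ← hp 1, Finset.smul_sum, Finset.smul_sum, ← Finset.sum_add_distrib] at hst
  rw [← hst]
  refine Finset.sum_congr rfl fun i _ => ?_
  rw [add_smul, smul_assoc, smul_assoc, smul_comm s, smul_comm t]

/-- Every basis of a block is a frame. -/
theorem IsAdmissible.mem_frames (hN : IsAdmissible F L N) {x y : Fin k → V} (hx : x ∈ frames V N)
    (hy : LinearIndependent F y)
    (hxy : Submodule.span F (Set.range y) = Submodule.span F (Set.range x)) : y ∈ frames V N := by
  have h1 : ∀ j, ∃ p : Fin k → F, ∑ i, p i • x i = y j := fun j =>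
    (Submodule.mem_span_range_iff_exists_fun F).1 (hxy ▸ Submodule.subset_span ⟨j, rfl⟩)
  have h2 : ∀ j, ∃ p : Fin k → F, ∑ i, p i • y i = x j := fun j =>
    (Submodule.mem_span_range_iff_exists_fun F).1 (hxy ▸ Submodule.subset_span ⟨j, rfl⟩)
  choose M hM using h1
  choose M' hM' using h2
  refine hN.substitution _ hx (Matrix.of M) (Matrix.of M') ?_ _ fun c => ?_
  · have : ∀ j, ∑ i, (Matrix.of M * Matrix.of M') j i • y i =
        ∑ i, (1 : Matrix (Fin k) (Fin k) F) j i • y i := by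
      intro j
      simp only [Matrix.mul_apply, Finset.sum_smul, Matrix.one_apply, ite_smul, one_smul, zero_smul,
        Finset.sum_ite_eq, Finset.mem_univ, if_true, Matrix.of_apply]
      rw [Finset.sum_comm, ← hM j]
      refine Finset.sum_congr rfl fun i _ => ?_
      rw [← hM' i, Finset.smul_sum]
      exact Finset.sum_congr rfl fun _ _ => mul_smul _ _ _
    ext j i
    have hz := Fintype.linearIndependent_iff.1 hy
      (fun i => (Matrix.of M * Matrix.of M') j i - (1 : Matrix (Fin k) (Fin k) F) j i)
      (by simp only [sub_smul, Finset.sum_sub_distrib, this, sub_self]) i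
    exact sub_eq_zero.1 hz
  · rw [mem_relations, mem_relations]
    have : ∑ i, Matrix.vecMul c ((Matrix.of M).map (algebraMap F L)) i • x i = ∑ j, c j • y j := by
      simp only [Matrix.vecMul, dotProduct, Finset.sum_smul, Matrix.map_apply, Matrix.of_apply]
      rw [Finset.sum_comm]
      refine Finset.sum_congr rfl fun j _ => ?_
      rw [← hM j, Finset.smul_sum]
      refine Finset.sum_congr rfl fun i _ => ?_
      rw [mul_smul, algebraMap_smul]
    rw [this]

theorem IsAdmissible.disjoint_blocks {N' : Set (Submodule L (Fin k → L))}
    (hN : IsAdmissible F L N) (hN' : IsAdmissible F L N') (h : Disjoint N N') :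
    Disjoint (blocks F V N) (blocks F V N') := by
  rw [Set.disjoint_left] at h ⊢
  rintro W ⟨x, hx, rfl⟩ ⟨y, hy, hxy⟩
  exact h (hN.mem_frames hx (hN'.linearIndependent hy) hxy) hy

theorem map_mem_blocks (g : V ≃ₗ[L] V) {W : Submodule F V}
    (hW : W ∈ blocks F V N) : W.map (g.restrictScalars F).toLinearMap ∈ blocks F V N := by
  obtain ⟨x, hx, rfl⟩ := hW
  refine ⟨fun i => g (x i), ?_, ?_⟩
  · change relations L _ ∈ N
    rw [relations_comp]
    exact hx
  · rw [Submodule.map_span, ← Set.range_comp]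
    rfl

theorem exists_linearEquiv_apply_eq {K E : Type*} [Field K] [AddCommGroup E] [Module K E]
    [Module.Finite K E] {ι : Type*} {y z : ι → E} (hy : LinearIndependent K y)
    (hz : LinearIndependent K z) : ∃ g : E ≃ₗ[K] E, ∀ i, g (y i) = z i := by
  let f := (LinearIndependent.linearCombinationEquiv hy).symm.trans
    (LinearIndependent.linearCombinationEquiv hz)
  obtain ⟨g, hg⟩ := Submodule.exists_linearEquiv_restrict_eq f
  refine ⟨g, fun i => ?_⟩
  have h1 : (LinearIndependent.linearCombinationEquiv hy).symm
      ⟨y i, Submodule.subset_span ⟨i, rfl⟩⟩ = Finsupp.single i 1 := by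
    rw [LinearEquiv.symm_apply_eq]
    ext
    simp
  have h := hg ⟨y i, Submodule.subset_span ⟨i, rfl⟩⟩
  rw [← h]
  simp only [f, LinearEquiv.trans_apply, h1]
  simp

end Frames

/-! ### Number of blocks through a pair -/

section BlockCounts

variable {F L : Type*} [Field F] [Field L] [Algebra F L] {k : ℕ}
variable {V : Type*} [AddCommGroup V] [Module F V] [Module L V] [IsScalarTower F L V]
variable {N : Set (Submodule L (Fin k → L))}

/-- `GL(V)` over `L` acts transitively on `L`-independent pairs, so they all lie in equally many
blocks. -/
theorem card_blocks_pair_eq [Module.Finite L V] {y z : Fin 2 → V} (hy : LinearIndependent L y)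
    (hz : LinearIndependent L z) :
    Nat.card {W : blocks F V N // ∀ i, y i ∈ W.1} =
      Nat.card {W : blocks F V N // ∀ i, z i ∈ W.1} := by
  obtain ⟨g, hg⟩ := exists_linearEquiv_apply_eq hy hz
  have hinj : ∀ g : V ≃ₗ[L] V, Function.Injective
      (Submodule.map (g.restrictScalars F).toLinearMap) := fun g =>
    Submodule.map_injective_of_injective (g.restrictScalars F).injective
  refine Nat.card_congr (Equiv.ofBijective (fun W => ⟨⟨_, map_mem_blocks g W.1.2⟩, fun i => ?_⟩)
    ⟨fun W W' h => ?_, fun W => ?_⟩)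
  · rw [← hg i]
    exact Submodule.mem_map_of_mem (W.2 i)
  · exact Subtype.ext (Subtype.ext (hinj g (congrArg (fun W => W.1.1) h)))
  · refine ⟨⟨⟨_, map_mem_blocks g.symm W.1.2⟩, fun i => ?_⟩, ?_⟩
    · exact ⟨z i, W.2 i, by rw [← hg i]; exact g.symm_apply_apply (y i)⟩
    · apply Subtype.ext
      apply Subtype.ext
      change (W.1.1.map _).map _ = W.1.1
      rw [← Submodule.map_comp]
      convert Submodule.map_id W.1.1
      ext v
      exact g.apply_symm_apply v

/-- Every basis of a block is a frame, so a block has as many frames as `GL(k, F)` has elements. -/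
theorem IsAdmissible.card_blocks_mul [Finite F] [Finite V] (hN : IsAdmissible F L N) :
    (Nat.card (blocks F V N) : ℚ) *
        ∏ j ∈ Finset.range k, ((Nat.card F : ℚ) ^ k - (Nat.card F : ℚ) ^ j) =
      Nat.card (frames V N) := by
  rw [card_mul_eq_card_mul (X := blocks F V N) (Y := frames V N)
    (fun W x => Submodule.span F (Set.range x.1) = W.1) (b := 1) (fun W => ?_) (fun x => ?_),
    mul_one]
  · rw [← card_bases W.1 (hN.finrank_eq W.2)]
    congr 1
    obtain ⟨x, hx, hxW⟩ := W.2
    refine Nat.card_congr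
      { toFun := fun y => ⟨y.1.1, hN.linearIndependent y.1.2, y.2⟩
        invFun := fun y => ⟨⟨y.1, hN.mem_frames hx y.2.1 (y.2.2.trans hxW.symm)⟩, y.2.2⟩
        left_inv := fun _ => rfl
        right_inv := fun _ => rfl }
  · rw [Nat.cast_eq_one, Nat.card_eq_one_iff_unique]
    exact ⟨⟨fun W W' => Subtype.ext (Subtype.ext (W.2.symm.trans W'.2))⟩,
      ⟨⟨⟨_, x.1, x.2, rfl⟩, rfl⟩⟩⟩

/-- The number of blocks containing an `L`-independent pair, in terms of the number of frames. -/
theorem IsAdmissible.card_blocks_pair [Finite F] [Finite L] [Finite V] (hN : IsAdmissible F L N)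
    {y : Fin 2 → V} (hy : LinearIndependent L y) :
    (Nat.card {W : blocks F V N // ∀ i, y i ∈ W.1} : ℚ) *
        (((Nat.card L : ℚ) ^ finrank L V - 1) * ((Nat.card L : ℚ) ^ finrank L V - Nat.card L)) *
        ∏ j ∈ Finset.range k, ((Nat.card F : ℚ) ^ k - (Nat.card F : ℚ) ^ j) =
      Nat.card (frames V N) *
        (((Nat.card F : ℚ) ^ k - 1) * ((Nat.card F : ℚ) ^ k - Nat.card F)) := by
  have h := card_mul_eq_card_mul (X := blocks F V N)
    (Y := {z : Fin 2 → V // LinearIndependent L z}) (fun W z => ∀ i, z.1 i ∈ W.1)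
    (a := ((Nat.card F : ℚ) ^ k - 1) * ((Nat.card F : ℚ) ^ k - Nat.card F))
    (b := Nat.card {W : blocks F V N // ∀ i, y i ∈ W.1}) (fun W => ?_)
    (fun z => by rw [card_blocks_pair_eq z.2 hy])
  · have h2 := card_linearIndependent_cast L V 2
    rw [Finset.prod_range_succ, Finset.prod_range_one, pow_zero, pow_one] at h2
    rw [h2] at h
    rw [← hN.card_blocks_mul, mul_comm (Nat.card {W : blocks F V N // ∀ i, y i ∈ W.1} : ℚ), ← h]
    ring
  · have h2 := card_linearIndependent_cast F W.1 2
    rw [Finset.prod_range_succ, Finset.prod_range_one, pow_zero, pow_one, hN.finrank_eq W.2] at h2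
    rw [← h2]
    congr 1
    refine Nat.card_congr
      { toFun := fun z => ⟨fun i => ⟨z.1.1 i, z.2 i⟩, ?_⟩
        invFun := fun z => ⟨⟨fun i => (z.1 i : V), ?_⟩, fun i => (z.1 i).2⟩
        left_inv := fun _ => rfl
        right_inv := fun _ => rfl }
    · exact LinearIndependent.of_comp W.1.subtype (z.1.2.restrict_scalars' F)
    · exact hN.linearIndependent_pair W.2
        (z.2.map' W.1.subtype (Submodule.ker_subtype _)) fun i => (z.1 i).2

end BlockCounts

section Families

variable {F L : Type*} [Field F] [Field L] [Algebra F L] {k : ℕ}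

variable (F L k) in
theorem isAdmissible_bot : IsAdmissible F L ({⊥} : Set (Submodule L (Fin k → L))) where
  eq_zero := by
    rintro _ rfl c hc _
    exact hc
  substitution := by
    rintro _ rfl M M' h R' hR'
    rw [Set.mem_singleton_iff, eq_bot_iff]
    intro c hc
    have h0 : Matrix.vecMul c (M.map (algebraMap F L)) = 0 := (hR' c).1 hc
    have h1 : M.map (algebraMap F L) * M'.map (algebraMap F L) = 1 := by
      rw [← Matrix.map_mul, h]
      simp
    have h2 := congrArg (fun v => Matrix.vecMul v (M'.map (algebraMap F L))) h0
    simpa [Matrix.vecMul_vecMul, h1] using h2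

variable (k) in
/-- The lines of `L ^ k` spanned by a vector whose coordinates span the `F`-subspace `A` of `L`. -/
def lineRelations (A : Submodule F L) : Set (Submodule L (Fin k → L)) :=
  {R | ∃ a : Fin k → L, Submodule.span F (Set.range a) = A ∧ R = L ∙ a}

theorem span_range_vecMul_le (a : Fin k → L) (M : Matrix (Fin k) (Fin k) F) :
    Submodule.span F (Set.range (Matrix.vecMul a (M.map (algebraMap F L)))) ≤
      Submodule.span F (Set.range a) := by
  rw [Submodule.span_le]
  rintro _ ⟨j, rfl⟩
  change ∑ i, a i * M.map (algebraMap F L) i j ∈ Submodule.span F (Set.range a)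
  refine Submodule.sum_mem _ fun i _ => ?_
  rw [Matrix.map_apply, mul_comm, ← Algebra.smul_def]
  exact Submodule.smul_mem _ _ (Submodule.subset_span ⟨i, rfl⟩)

theorem span_range_smul (c : Lˣ) (a : Fin k → L) :
    Submodule.span F (Set.range (c • a)) = c • Submodule.span F (Set.range a) := by
  rw [Units.smul_def c (Submodule.span F _), Submodule.pointwise_smul_def, Submodule.map_span,
    ← Set.range_comp]
  rfl

theorem finrank_units_smul (c : Lˣ) (A : Submodule F L) :
    finrank F (c • A : Submodule F L) = finrank F A :=
  (Submodule.equivMapOfInjective (DistribSMul.toLinearMap F L c)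
    (MulAction.injective _) A).finrank_eq.symm

theorem exists_units_smul_of_span_eq {a b : Fin k → L} (hb : b ≠ 0) (h : (L ∙ a) = L ∙ b) :
    ∃ c : Lˣ, b = c • a := by
  obtain ⟨t, ht⟩ := Submodule.mem_span_singleton.1 (h ▸ Submodule.mem_span_singleton_self b)
  have ht0 : t ≠ 0 := by
    rintro rfl
    exact hb (by rw [← ht, zero_smul])
  exact ⟨Units.mk0 t ht0, ht.symm⟩

theorem ne_zero_of_span_range_eq {A : Submodule F L} (hA : A ≠ ⊥) {a : Fin k → L}
    (ha : Submodule.span F (Set.range a) = A) : a ≠ 0 := by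
  rintro rfl
  apply hA
  rw [← ha, Submodule.span_eq_bot]
  rintro _ ⟨i, rfl⟩
  rfl

/-- The admissibility of a line of relations comes from `dim A ≥ 3`. -/
theorem isAdmissible_lineRelations {A : Submodule F L} (hA : 3 ≤ finrank F A) :
    IsAdmissible F L (lineRelations k A) where
  eq_zero := by
    rintro _ ⟨a, ha, rfl⟩ c hc hc2
    by_contra hc0
    obtain ⟨t, rfl⟩ := Submodule.mem_span_singleton.1 hc
    have ht : t ≠ 0 := by
      rintro rfl
      exact hc0 (zero_smul _ _)
    have h1 := span_range_smul (F := F) (Units.mk0 t ht) a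
    change Submodule.span F (Set.range (t • a)) = _ at h1
    rw [h1, ha] at hc2
    rw [finrank_units_smul] at hc2
    omega
  substitution := by
    rintro _ ⟨a, rfl, rfl⟩ M M' h R' hR'
    have h1 : M.map (algebraMap F L) * M'.map (algebraMap F L) = 1 := by
      rw [← Matrix.map_mul, h]
      simp
    have h2 : M'.map (algebraMap F L) * M.map (algebraMap F L) = 1 := mul_eq_one_comm.1 h1
    have h3 : Matrix.vecMul (Matrix.vecMul a (M'.map (algebraMap F L))) (M.map (algebraMap F L)) =
        a := by
      rw [Matrix.vecMul_vecMul, h2, Matrix.vecMul_one]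
    refine ⟨Matrix.vecMul a (M'.map (algebraMap F L)),
      le_antisymm (span_range_vecMul_le _ _) ?_, ?_⟩
    · conv_lhs => rw [← h3]
      exact span_range_vecMul_le _ _
    · ext c
      rw [hR', Submodule.mem_span_singleton, Submodule.mem_span_singleton]
      refine exists_congr fun t => ⟨fun ht => ?_, fun ht => ?_⟩
      · rw [← Matrix.smul_vecMul, ht, Matrix.vecMul_vecMul, h1, Matrix.vecMul_one]
      · rw [← ht, Matrix.smul_vecMul, h3]

theorem exists_smul_eq_of_not_disjoint_lineRelations {A A' : Submodule F L} (hA : A' ≠ ⊥)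
    (h : ¬ Disjoint (lineRelations k A) (lineRelations k A')) : ∃ c : Lˣ, A' = c • A := by
  obtain ⟨_, ⟨a, rfl, rfl⟩, ⟨b, rfl, hb⟩⟩ := Set.not_disjoint_iff.1 h
  obtain ⟨c, rfl⟩ := exists_units_smul_of_span_eq (ne_zero_of_span_range_eq hA rfl) hb
  exact ⟨c, span_range_smul c a⟩

theorem disjoint_lineRelations_bot {A : Submodule F L} (hA : A ≠ ⊥) :
    Disjoint (lineRelations k A) {⊥} := by
  rw [Set.disjoint_singleton_right]
  rintro ⟨a, ha, h⟩
  exact ne_zero_of_span_range_eq hA ha (Submodule.span_singleton_eq_bot.1 h.symm)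

variable (V : Type*) [AddCommGroup V] [Module L V]

theorem card_frames_bot [Finite L] [Finite V] :
    (Nat.card (frames V ({⊥} : Set (Submodule L (Fin k → L)))) : ℚ) =
      ∏ j ∈ Finset.range k, ((Nat.card L : ℚ) ^ finrank L V - (Nat.card L : ℚ) ^ j) := by
  have := card_relations_eq L (V := V) (⊥ : Submodule L (Fin k → L))
  rwa [finrank_bot, Nat.sub_zero] at this

/-- Count pairs of a frame and a spanning vector of its line of relations: the vectors that span the
same line and have the same coordinate span differ by the units stabilizing `A`. -/
theorem card_frames_lineRelations [Finite F] [Finite L] [Finite V] {A : Submodule F L}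
    (hA : A ≠ ⊥) :
    (Nat.card (frames V (lineRelations k A)) : ℚ) * Nat.card {c : Lˣ // c • A = A} =
      (∏ j ∈ Finset.range (finrank F A), ((Nat.card F : ℚ) ^ k - (Nat.card F : ℚ) ^ j)) *
      ∏ j ∈ Finset.range (k - 1), ((Nat.card L : ℚ) ^ finrank L V - (Nat.card L : ℚ) ^ j) := by
  rw [← card_spanning k A]
  refine card_mul_eq_card_mul (X := frames V (lineRelations k A))
    (Y := {a : Fin k → L // Submodule.span F (Set.range a) = A})
    (fun x a => relations L x.1 = L ∙ a.1) (fun x => ?_) (fun a => ?_)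
  · obtain ⟨a, ha, hxa⟩ := x.2
    congr 1
    symm
    have ha0 : a ≠ 0 := ne_zero_of_span_range_eq hA ha
    refine Nat.card_congr (Equiv.ofBijective (fun c => ⟨⟨c.1 • a, ?_⟩, ?_⟩) ⟨?_, ?_⟩)
    · rw [span_range_smul, ha, c.2]
    · rw [hxa]
      exact (Submodule.span_singleton_smul_eq c.1.isUnit a).symm
    · intro c c' h
      have h1 : (c.1 : L) • a = (c'.1 : L) • a := congrArg (fun b => b.1.1) h
      exact Subtype.ext (Units.ext (smul_left_injective L ha0 h1))
    · rintro ⟨⟨b, hb⟩, hxb⟩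
      obtain ⟨c, rfl⟩ := exists_units_smul_of_span_eq (ne_zero_of_span_range_eq hA hb)
        (hxa.symm.trans hxb)
      rw [span_range_smul, ha] at hb
      exact ⟨⟨c, hb⟩, rfl⟩
  · have h := card_relations_eq L (V := V) (L ∙ a.1)
    rw [finrank_span_singleton (ne_zero_of_span_range_eq hA a.2)] at h
    rw [← h]
    congr 1
    exact Nat.card_congr
      { toFun := fun x => ⟨x.1.1, x.2⟩
        invFun := fun x => ⟨⟨x.1, a.1, a.2, x.2⟩, x.2⟩
        left_inv := fun _ => rfl
        right_inv := fun _ => rfl }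

end Families

/-! ### Singer cycles and the copies of a design on the `L`-lines -/

section Singer

variable {F L U : Type*} [Field F] [Field L] [Algebra F L] [AddCommGroup U] [Module F U]

/-- The action of `Lˣ` on `U` by multiplication under the identification `φ` of `U` with `L`. -/
def scalarHom (φ : U ≃ₗ[F] L) : Lˣ →* (U ≃ₗ[F] U) where
  toFun c := (φ.trans (DistribMulAction.toModuleAut F L c)).trans φ.symm
  map_one' := by
    ext x
    simp
  map_mul' c d := by
    ext x
    simp [mul_smul]

theorem scalarHom_apply (φ : U ≃ₗ[F] L) (c : Lˣ) (x : U) :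
    φ (scalarHom φ c x) = c * φ x :=
  φ.apply_symm_apply _

theorem scalarHom_injective (φ : U ≃ₗ[F] L) : Function.Injective (scalarHom φ) := by
  intro c d h
  have h1 := scalarHom_apply φ c (φ.symm 1)
  rw [h, scalarHom_apply, φ.apply_symm_apply, mul_one, mul_one] at h1
  exact Units.ext h1.symm

theorem IsSingerCycle.exists_eq_range {H : Subgroup (U ≃ₗ[F] U)} (hH : IsSingerCycle L H) :
    ∃ φ : U ≃ₗ[F] L, H = (scalarHom φ).range := by
  obtain ⟨φ, w, T, hw, hT, rfl⟩ := hH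
  refine ⟨φ, ?_⟩
  have : T = scalarHom φ w := by
    ext x
    apply φ.injective
    rw [hT, scalarHom_apply]
  rw [this, ← MonoidHom.map_zpowers, (Subgroup.eq_top_iff' _).2 hw, MonoidHom.range_eq_map]

theorem map_smul_scalarHom (φ : U ≃ₗ[F] L) (c : Lˣ) (W : Submodule F U) :
    (scalarHom φ c • W).map φ.toLinearMap = c • W.map φ.toLinearMap := by
  rw [Units.smul_def c (Submodule.map _ _), Submodule.pointwise_smul_def,
    Submodule.pointwise_smul_def, ← Submodule.map_comp, ← Submodule.map_comp]
  congr 1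
  ext x
  exact scalarHom_apply φ c x

theorem card_stabilizer_scalarHom (φ : U ≃ₗ[F] L) (W : Submodule F U) :
    Nat.card (MulAction.stabilizer (scalarHom φ).range W) =
      Nat.card {c : Lˣ // c • W.map φ.toLinearMap = W.map φ.toLinearMap} := by
  have hinj := Submodule.map_injective_of_injective (f := φ.toLinearMap) φ.injective
  symm
  refine Nat.card_congr (Equiv.ofBijective (fun c => ⟨⟨scalarHom φ c.1, c.1, rfl⟩, ?_⟩) ⟨?_, ?_⟩)
  · apply hinj
    exact (map_smul_scalarHom φ c.1 W).trans c.2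
  · intro c d h
    exact Subtype.ext (scalarHom_injective φ (congrArg (fun h => h.1.1) h))
  · rintro ⟨⟨_, c, rfl⟩, hc⟩
    refine ⟨⟨c, ?_⟩, rfl⟩
    rw [← map_smul_scalarHom]
    exact congrArg (Submodule.map φ.toLinearMap) hc

theorem orbit_eq_of_map_eq_smul {φ : U ≃ₗ[F] L} {W W' : Submodule F U} {c : Lˣ}
    (h : W'.map φ.toLinearMap = c • W.map φ.toLinearMap) :
    MulAction.orbit (scalarHom φ).range W' = MulAction.orbit (scalarHom φ).range W := by
  have hinj := Submodule.map_injective_of_injective (f := φ.toLinearMap) φ.injective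
  rw [MulAction.orbit_eq_iff]
  refine ⟨⟨scalarHom φ c, c, rfl⟩, hinj ?_⟩
  exact (map_smul_scalarHom φ c W).trans h.symm

/-- Selects orbits counted by `orbitCount` together with representatives. The isomorphism type of a
stabilizer enters only through the order `q ^ u - 1`. -/
theorem exists_orbit_representatives [Finite F] (H : Subgroup (U ≃ₗ[F] U)) {d u n : ℕ}
    (h : n ≤ orbitCount H d u) :
    ∃ S : Finset (Set (Submodule F U)), S.card = n ∧ ∀ O ∈ S, ∃ W : Submodule F U,
      finrank F W = d ∧ Nat.card (MulAction.stabilizer H W) + 1 = Nat.card F ^ u ∧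
      O = MulAction.orbit H W := by
  rcases Nat.eq_zero_or_pos n with rfl | hn
  · exact ⟨∅, rfl, by simp⟩
  obtain ⟨S, hS, hSn⟩ := Set.exists_subset_card_eq h
  have hfin : S.Finite := Set.finite_of_ncard_pos (hSn.symm ▸ hn)
  refine ⟨hfin.toFinset, by rw [← hSn, Set.ncard_eq_toFinset_card S hfin], fun O hO => ?_⟩
  obtain ⟨W, hW, ⟨E, _, hE, ⟨e⟩⟩, hO⟩ := hS (hfin.mem_toFinset.1 hO)
  have hpos : 0 < Nat.card E := hE ▸ pow_pos Nat.card_pos u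
  have : Finite E := Nat.finite_of_card_ne_zero hpos.ne'
  refine ⟨W, hW, ?_, hO⟩
  rw [Nat.card_congr e.toEquiv, Nat.card_units, ← hE]
  omega

end Singer

section LineDesign

variable {F L : Type*} [Field F] [Field L] [Algebra F L] {U : Type*} [AddCommGroup U] [Module F U]
variable {V : Type*} [AddCommGroup V] [Module F V] [Module L V] [IsScalarTower F L V]

/-- The parametrization `x ↦ φ x • v` of the `L`-line through `v`. -/
def lineMap (φ : U ≃ₗ[F] L) (v : V) : U →ₗ[F] V :=
  (LinearMap.toSpanSingleton L V v).restrictScalars F ∘ₗ φ.toLinearMap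

theorem lineMap_apply (φ : U ≃ₗ[F] L) (v : V) (x : U) : lineMap φ v x = φ x • v := rfl

theorem lineMap_injective (φ : U ≃ₗ[F] L) {v : V} (hv : v ≠ 0) :
    Function.Injective (lineMap φ v) := fun _ _ h => φ.injective (smul_left_injective L hv h)

theorem range_lineMap (φ : U ≃ₗ[F] L) (v : V) :
    LinearMap.range (lineMap φ v) = (L ∙ v).restrictScalars F := by
  ext x
  rw [Submodule.restrictScalars_mem, Submodule.mem_span_singleton]
  constructor
  · rintro ⟨y, rfl⟩
    exact ⟨φ y, rfl⟩
  · rintro ⟨c, rfl⟩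
    exact ⟨φ.symm c, by rw [lineMap_apply, φ.apply_symm_apply]⟩

/-- Invariance under the Singer cycle makes the copy of the design on an `L`-line independent of the
chosen vector. -/
theorem map_lineMap_smul {φ : U ≃ₗ[F] L} {D : Multiset (Submodule F U)}
    (hD : IsAutomorphismGroup (scalarHom φ).range D) (c : Lˣ) (v : V) :
    D.map (Submodule.map (lineMap φ (c • v))) = D.map (Submodule.map (lineMap φ v)) := by
  conv_rhs => rw [← hD (scalarHom φ c) ⟨c, rfl⟩, Multiset.map_map]
  refine Multiset.map_congr rfl fun W _ => ?_
  rw [Function.comp_apply, Submodule.pointwise_smul_def, ← Submodule.map_comp]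
  congr 1
  ext x
  change φ x • c • v = φ (scalarHom φ c x) • v
  rw [scalarHom_apply, mul_comm, mul_smul]
  rfl

theorem not_linearIndependent_of_mem {M : Submodule L V} (hM : finrank L M = 1) {y : Fin 2 → V}
    (hy : ∀ i, y i ∈ M) : ¬ LinearIndependent L y := by
  intro h
  have h1 : LinearIndependent L (fun i => (⟨y i, hy i⟩ : M)) :=
    LinearIndependent.of_comp M.subtype h
  have : Module.Finite L M := Module.finite_of_finrank_pos (hM ▸ one_pos)
  have h2 := h1.fintype_card_le_finrank
  rw [hM, Fintype.card_fin] at h2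
  omega

open Classical in
theorem countP_map_lineMap {l lam : ℕ} {K : Set ℕ} {φ : U ≃ₗ[F] L} {D : Multiset (Submodule F U)}
    (hD : IsPBD l K lam D) {v : V} (hv : v ≠ 0) {T : Submodule F V} (hT : finrank F T = 2) :
    (D.map (Submodule.map (lineMap φ v))).countP (fun W => T ≤ W) =
      if T ≤ (L ∙ v).restrictScalars F then lam else 0 := by
  rw [← range_lineMap φ v]
  split_ifs with h
  · have h1 : (T.comap (lineMap φ v)).map (lineMap φ v) = T := Submodule.map_comap_eq_of_le h
    have h2 : finrank F (T.comap (lineMap φ v)) = 2 := by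
      rw [← hT]
      conv_rhs => rw [← h1]
      exact (Submodule.equivMapOfInjective _ (lineMap_injective φ hv) _).finrank_eq
    rw [← hD.balanced _ h2, Multiset.countP_map, Multiset.countP_eq_card_filter]
    congr 1
    refine Multiset.filter_congr fun W _ => ?_
    constructor
    · intro hW x hx
      obtain ⟨y, hy, hxy⟩ := hW hx
      rwa [← lineMap_injective φ hv hxy]
    · intro hW
      rw [← h1]
      exact Submodule.map_mono hW
  · rw [Multiset.countP_eq_zero]
    intro W hW hTW
    obtain ⟨W', -, rfl⟩ := Multiset.mem_map.1 hW
    exact h (hTW.trans LinearMap.map_le_range)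

open scoped LinearAlgebra.Projectivization

variable [Finite V]

attribute [local instance] Fintype.ofFinite

variable (L V) in
/-- The blocks of `D` copied onto every `L`-line of `V`. -/
noncomputable def lineDesign (φ : U ≃ₗ[F] L) (D : Multiset (Submodule F U)) :
    Multiset (Submodule F V) :=
  ∑ P : ℙ L V, D.map (Submodule.map (lineMap φ P.rep))

theorem mem_lineDesign {φ : U ≃ₗ[F] L} {D : Multiset (Submodule F U)} {W : Submodule F V} :
    W ∈ lineDesign L V φ D ↔ ∃ P : ℙ L V, ∃ W' ∈ D, W'.map (lineMap φ P.rep) = W := by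
  simp [lineDesign, Multiset.mem_sum]

theorem isAutomorphismGroup_lineDesign {φ : U ≃ₗ[F] L} {D : Multiset (Submodule F U)}
    (hD : IsAutomorphismGroup (scalarHom φ).range D) :
    IsAutomorphismGroup (extGL F L V) (lineDesign L V φ D) := by
  intro g hg
  let g' : V ≃ₗ[L] V := { g with map_smul' := hg }
  let f : ℙ L V → Multiset (Submodule F V) := fun P => D.map (Submodule.map (lineMap φ P.rep))
  have key : ∀ P : ℙ L V, (f P).map (fun W => g • W) = f (g' • P) := by
    intro P
    have h1 : g' • P = Projectivization.mk L (g' P.rep)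
        ((smul_ne_zero_iff_ne g').2 P.rep_nonzero) := by
      conv_lhs => rw [← P.mk_rep]
      rfl
    obtain ⟨c, hc⟩ := Projectivization.exists_smul_eq_mk_rep L (g' P.rep)
      ((smul_ne_zero_iff_ne g').2 P.rep_nonzero)
    simp only [f]
    rw [h1, ← hc, map_lineMap_smul hD, Multiset.map_map]
    refine Multiset.map_congr rfl fun W _ => ?_
    rw [Function.comp_apply, Submodule.pointwise_smul_def, ← Submodule.map_comp]
    congr 1
    ext x
    exact hg (φ x) P.rep
  change (∑ P, f P).map _ = ∑ P, f P
  rw [← Multiset.coe_mapAddMonoidHom, map_sum]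
  simp only [Multiset.coe_mapAddMonoidHom, key]
  exact Equiv.sum_comp (MulAction.toPerm g') f

theorem nodup_lineDesign {φ : U ≃ₗ[F] L} {D : Multiset (Submodule F U)}
    (hD : D.Nodup) (hpos : ∀ W ∈ D, W ≠ ⊥) : (lineDesign L V φ D).Nodup := by
  change Multiset.Nodup (Multiset.bind Finset.univ.val fun P : ℙ L V =>
    D.map (Submodule.map (lineMap φ P.rep)))
  rw [Multiset.nodup_bind]
  refine ⟨fun P _ => hD.map (Submodule.map_injective_of_injective
    (lineMap_injective φ P.rep_nonzero)), Finset.univ.nodup.pairwise fun P _ Q _ hPQ => ?_⟩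
  rw [Function.onFun, Multiset.disjoint_left]
  intro W hP hQ
  obtain ⟨W₁, hW₁, rfl⟩ := Multiset.mem_map.1 hP
  obtain ⟨W₂, hW₂, h⟩ := Multiset.mem_map.1 hQ
  obtain ⟨x, hx, hx0⟩ := Submodule.exists_mem_ne_zero_of_ne_bot (hpos W₁ hW₁)
  have hmem : lineMap φ P.rep x ∈ W₂.map (lineMap φ Q.rep) := h ▸ Submodule.mem_map_of_mem hx
  obtain ⟨y, -, hy⟩ := hmem
  have hφ : φ x ≠ 0 := fun h => hx0 (φ.map_eq_zero_iff.1 h)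
  apply hPQ
  rw [← P.mk_rep, ← Q.mk_rep, Projectivization.mk_eq_mk_iff']
  refine ⟨(φ x)⁻¹ * φ y, ?_⟩
  rw [mul_smul, ← lineMap_apply, hy, lineMap_apply, smul_smul, inv_mul_cancel₀ hφ, one_smul]

open Classical in
theorem countP_lineDesign {l lam : ℕ} {K : Set ℕ} {φ : U ≃ₗ[F] L} {D : Multiset (Submodule F U)}
    (hD : IsPBD l K lam D) {T : Submodule F V} (hT : finrank F T = 2) :
    (lineDesign L V φ D).countP (fun W => T ≤ W) =
      ∑ P : ℙ L V, if T ≤ P.submodule.restrictScalars F then lam else 0 := by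
  rw [lineDesign, ← Multiset.coe_countPAddMonoidHom, map_sum]
  refine Finset.sum_congr rfl fun P _ => ?_
  rw [Multiset.coe_countPAddMonoidHom, countP_map_lineMap hD P.rep_nonzero hT, P.submodule_eq]

open Classical in
/-- `L`-independent pairs lie in no block of the line design. -/
theorem countP_lineDesign_of_linearIndependent {l lam : ℕ} {K : Set ℕ} {φ : U ≃ₗ[F] L}
    {D : Multiset (Submodule F U)} (hD : IsPBD l K lam D) {T : Submodule F V}
    (hT : finrank F T = 2) {y : Fin 2 → V} (hy : ∀ i, y i ∈ T) (hli : LinearIndependent L y) :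
    (lineDesign L V φ D).countP (fun W => T ≤ W) = 0 := by
  rw [countP_lineDesign hD hT]
  refine Finset.sum_eq_zero fun P _ => if_neg fun h => ?_
  exact not_linearIndependent_of_mem P.finrank_submodule (fun i => h (hy i)) hli

open Classical in
/-- A `2`-subspace whose bases are `L`-dependent lies on exactly one `L`-line. -/
theorem countP_lineDesign_of_not_linearIndependent {l lam : ℕ} {K : Set ℕ} {φ : U ≃ₗ[F] L}
    {D : Multiset (Submodule F U)} (hD : IsPBD l K lam D) {y : Fin 2 → V}
    (hy : LinearIndependent F y) (hli : ¬ LinearIndependent L y) :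
    (lineDesign L V φ D).countP (fun W => Submodule.span F (Set.range y) ≤ W) = lam := by
  rw [countP_lineDesign hD (by rw [finrank_span_eq_card hy, Fintype.card_fin])]
  have h0 : y 0 ≠ 0 := hy.ne_zero 0
  have hy2 : y = ![y 0, y 1] := by funext j; fin_cases j <;> rfl
  obtain ⟨a, ha⟩ : ∃ a : L, a • y 0 = y 1 := by
    by_contra! h
    rw [hy2] at hli
    exact hli ((LinearIndependent.pair_iff' h0).2 h)
  have key : ∀ P : ℙ L V, Submodule.span F (Set.range y) ≤ P.submodule.restrictScalars F ↔
      P = Projectivization.mk L (y 0) h0 := by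
    intro P
    constructor
    · intro h
      have h1 : y 0 ∈ P.submodule := h (Submodule.subset_span ⟨0, rfl⟩)
      rw [P.submodule_eq, Submodule.mem_span_singleton] at h1
      rw [eq_comm, ← P.mk_rep, Projectivization.mk_eq_mk_iff']
      exact h1
    · rintro rfl
      rw [Submodule.span_le]
      rintro _ ⟨i, rfl⟩
      change y i ∈ (Projectivization.mk L (y 0) h0).submodule
      rw [Projectivization.submodule_mk, Submodule.mem_span_singleton]
      fin_cases i
      · exact ⟨1, one_smul _ _⟩
      · exact ⟨a, ha⟩
  simp [key]

end LineDesign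

/-! ### Union of the two parts -/

section Assembly

variable {F L : Type*} [Field F] [Field L] {U : Type*} [AddCommGroup U] [Module F U]
variable {V : Type*} [AddCommGroup V] [Module F V] [Module L V]

theorem smul_mem_blocks [Algebra F L] [IsScalarTower F L V] {k : ℕ}
    {N : Set (Submodule L (Fin k → L))} {g : V ≃ₗ[F] V}
    (hg : g ∈ extGL F L V) {W : Submodule F V} (hW : W ∈ blocks F V N) : g • W ∈ blocks F V N :=
  map_mem_blocks (N := N) ({ g with map_smul' := hg } : V ≃ₗ[L] V) hW

attribute [local instance] Fintype.ofFinite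

variable (F V) in
open Classical in
/-- The set `blocks F V N` as a multiset without repetitions. -/
noncomputable def blockMultiset [Finite V] {k : ℕ} (N : Set (Submodule L (Fin k → L))) :
    Multiset (Submodule F V) :=
  (blocks F V N).toFinset.val

variable [Finite V]

theorem mem_blockMultiset {k : ℕ} {N : Set (Submodule L (Fin k → L))} {W : Submodule F V} :
    W ∈ blockMultiset F V N ↔ W ∈ blocks F V N := by
  simp [blockMultiset]

theorem nodup_blockMultiset {k : ℕ} {N : Set (Submodule L (Fin k → L))} :
    (blockMultiset F V N).Nodup := Finset.nodup _

open Classical in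
theorem countP_blockMultiset {k : ℕ} {N : Set (Submodule L (Fin k → L))} (y : Fin 2 → V) :
    (blockMultiset F V N).countP (fun W => Submodule.span F (Set.range y) ≤ W) =
      Nat.card {W : blocks F V N // ∀ i, y i ∈ W.1} := by
  rw [blockMultiset, Multiset.countP_eq_card_filter, ← Finset.filter_val, Finset.card_val,
    ← Nat.card_eq_finsetCard]
  refine Nat.card_congr
    { toFun := fun W => ⟨⟨W.1, Set.mem_toFinset.1 (Finset.mem_filter.1 W.2).1⟩, fun i =>
        (Finset.mem_filter.1 W.2).2 (Submodule.subset_span ⟨i, rfl⟩)⟩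
      invFun := fun W => ⟨W.1.1, Finset.mem_filter.2 ⟨Set.mem_toFinset.2 W.1.2, ?_⟩⟩
      left_inv := fun _ => rfl
      right_inv := fun _ => rfl }
  rw [Submodule.span_le]
  rintro _ ⟨i, rfl⟩
  exact W.2 i

variable [Algebra F L] [IsScalarTower F L V]

theorem isAutomorphismGroup_blockMultiset {k : ℕ} (N : Set (Submodule L (Fin k → L))) :
    IsAutomorphismGroup (extGL F L V) (blockMultiset F V N) := by
  intro g hg
  refine (Multiset.Nodup.ext (nodup_blockMultiset.map (MulAction.injective g))
    nodup_blockMultiset).2 fun W => ?_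
  rw [Multiset.mem_map]
  constructor
  · rintro ⟨W', hW', rfl⟩
    exact mem_blockMultiset.2 (smul_mem_blocks hg (mem_blockMultiset.1 hW'))
  · intro hW
    exact ⟨g⁻¹ • W, mem_blockMultiset.2
      (smul_mem_blocks ((extGL F L V).inv_mem hg) (mem_blockMultiset.1 hW)), smul_inv_smul g W⟩

open Classical in
/-- The copies of `D` on the `L`-lines cover the pairs that are dependent over `L`, and admissible
families of blocks cover those that are independent. Blocks of `D` of dimension at most one, which
contain no `2`-subspace, are discarded: the zero subspace would be repeated on every line. -/
theorem exists_pbd_of_admissible [Finite F] [Finite L] {ι : Type*} {l v k lam : ℕ} (hk : 2 ≤ k)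
    (hv : finrank F V = v) (J : Finset ι) (N : ι → Set (Submodule L (Fin k → L)))
    (hN : ∀ j ∈ J, IsAdmissible F L (N j))
    (hdisj : ∀ i ∈ J, ∀ j ∈ J, i ≠ j → Disjoint (N i) (N j))
    (hcard : ∀ y : Fin 2 → V, LinearIndependent L y →
      ∑ j ∈ J, Nat.card {W : blocks F V (N j) // ∀ i, y i ∈ W.1} = lam)
    {φ : U ≃ₗ[F] L} {K : Set ℕ} {D : Multiset (Submodule F U)} (hD : IsPBD l K lam D)
    (hDH : IsAutomorphismGroup (scalarHom φ).range D) :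
    ∃ A : Multiset (Submodule F V), IsPBD v (K ∪ {k}) lam A ∧
      IsAutomorphismGroup (extGL F L V) A ∧ (IsSimple D → IsSimple A) := by
  have : Finite U := Finite.of_injective φ φ.injective
  let D₂ : Multiset (Submodule F U) := D.filter fun W => 2 ≤ finrank F W
  have hD₂ : IsPBD l K lam D₂ :=
    { finrank_eq := hD.finrank_eq
      finrank_mem := fun W hW => hD.finrank_mem W (Multiset.mem_filter.1 hW).1
      balanced := fun T hT => by
        rw [← hD.balanced T hT, Multiset.countP_filter]
        refine Multiset.countP_congr rfl fun W _ => ?_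
        simp only [eq_iff_iff, and_iff_left_iff_imp]
        exact fun h => hT ▸ Submodule.finrank_mono h }
  have hDH₂ : IsAutomorphismGroup (scalarHom φ).range D₂ := by
    intro g hg
    have hfin : ∀ W : Submodule F U, finrank F (g • W : Submodule F U) = finrank F W := fun W =>
      (Submodule.equivMapOfInjective _ g.injective W).finrank_eq.symm
    conv_rhs =>
      rw [show D₂ = D.filter fun W : Submodule F U => 2 ≤ finrank F W from rfl, ← hDH g hg]
    rw [Multiset.filter_map]
    simp only [D₂, Function.comp_def, hfin]
  let B : Multiset (Submodule F V) := ∑ j ∈ J, blockMultiset F V (N j)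
  have hB : ∀ W ∈ B, ∃ j ∈ J, W ∈ blocks F V (N j) := fun W hW => by
    obtain ⟨j, hj, hW⟩ := Multiset.mem_sum.1 hW
    exact ⟨j, hj, mem_blockMultiset.1 hW⟩
  have hBcount : ∀ y : Fin 2 → V,
      B.countP (fun W => Submodule.span F (Set.range y) ≤ W) =
        ∑ j ∈ J, Nat.card {W : blocks F V (N j) // ∀ i, y i ∈ W.1} := by
    intro y
    simp only [B, ← Multiset.coe_countPAddMonoidHom, map_sum]
    exact Finset.sum_congr rfl fun j _ => countP_blockMultiset y
  refine ⟨lineDesign L V φ D₂ + B, ⟨hv, fun W hW => ?_, fun T hT => ?_⟩, fun g hg => ?_,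
    fun hs => ?_⟩
  · rcases Multiset.mem_add.1 hW with hW | hW
    · obtain ⟨P, W', hW', rfl⟩ := mem_lineDesign.1 hW
      left
      rw [← (Submodule.equivMapOfInjective _ (lineMap_injective φ P.rep_nonzero) W').finrank_eq]
      exact hD₂.finrank_mem W' hW'
    · obtain ⟨j, hj, hW⟩ := hB W hW
      exact Or.inr ((hN j hj).finrank_eq hW)
  · let b := finBasisOfFinrankEq F T hT
    let y : Fin 2 → V := fun i => b i
    have hy : LinearIndependent F y := b.linearIndependent.map' T.subtype (Submodule.ker_subtype _)
    have hyT : Submodule.span F (Set.range y) = T := by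
      rw [show y = T.subtype ∘ b from rfl, Set.range_comp, ← Submodule.map_span, b.span_eq,
        Submodule.map_top, Submodule.range_subtype]
    rw [Multiset.countP_add]
    by_cases hli : LinearIndependent L y
    · rw [countP_lineDesign_of_linearIndependent hD₂ hT (fun i => (b i).2) hli, zero_add, ← hyT,
        hBcount, hcard y hli]
    · rw [← hyT, countP_lineDesign_of_not_linearIndependent hD₂ hy hli, hBcount,
        Finset.sum_eq_zero, add_zero]
      intro j hj
      rw [Nat.card_eq_zero]
      exact Or.inl ⟨fun W => hli ((hN j hj).linearIndependent_pair W.1.2 hy W.2)⟩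
  · rw [Multiset.map_add, isAutomorphismGroup_lineDesign hDH₂ g hg]
    congr 1
    simp only [B]
    rw [← Multiset.coe_mapAddMonoidHom, map_sum]
    exact Finset.sum_congr rfl fun j _ => isAutomorphismGroup_blockMultiset (N j) g hg
  · refine Multiset.nodup_add.2 ⟨nodup_lineDesign (Multiset.Nodup.filter _ hs) ?_, ?_, ?_⟩
    · rintro W hW rfl
      have := (Multiset.mem_filter.1 hW).2
      rw [finrank_bot] at this
      omega
    · change Multiset.Nodup (Multiset.bind J.val fun j => blockMultiset F V (N j))
      rw [Multiset.nodup_bind]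
      refine ⟨fun _ _ => nodup_blockMultiset, J.nodup.pairwise fun i hi j hj hij => ?_⟩
      rw [Function.onFun, Multiset.disjoint_left]
      intro W hWi hWj
      exact Set.disjoint_left.1 ((hN i hi).disjoint_blocks (hN j hj) (hdisj i hi j hj hij))
        (mem_blockMultiset.1 hWi) (mem_blockMultiset.1 hWj)
    · rw [Multiset.disjoint_left]
      -- A common block would contain an `F`-independent pair both on an `L`-line and
      -- independent over `L`.
      intro W hW hWB
      obtain ⟨j, hj, hWj⟩ := hB W hWB
      obtain ⟨P, W', -, rfl⟩ := mem_lineDesign.1 hW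
      have hfin := (hN j hj).finrank_eq hWj
      let b := finBasisOfFinrankEq F _ hfin
      let y : Fin 2 → V := fun i => b (Fin.castLE hk i)
      have hy : LinearIndependent F y :=
        (b.linearIndependent.comp _ (Fin.castLE_injective hk)).map' (Submodule.subtype _)
          (Submodule.ker_subtype _)
      refine not_linearIndependent_of_mem P.finrank_submodule (y := y) (fun i => ?_)
        ((hN j hj).linearIndependent_pair hWj hy fun i => (b _).2)
      have h1 := LinearMap.map_le_range (b (Fin.castLE hk i)).2
      rw [range_lineMap, ← P.submodule_eq] at h1
      exact h1

end Assembly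

/-! ### Evaluation of the multiplicities -/

section Values

theorem prod_range_eq_mul_prod_Icc (f : ℕ → ℚ) {n : ℕ} (hn : 2 ≤ n) :
    ∏ j ∈ Finset.range n, f j = f 0 * f 1 * ∏ j ∈ Finset.Icc 2 (n - 1), f j := by
  rw [← Finset.prod_range_mul_prod_Ico f hn, Finset.prod_range_succ, Finset.prod_range_one,
    show Finset.Icc 2 (n - 1) = Finset.Ico 2 n by ext; simp; omega]

theorem sum_Icc_two (k : ℕ) (hk : 2 ≤ k) : ∑ j ∈ Finset.Icc 2 (k - 1), j = k.choose 2 - 1 := by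
  have h := Finset.sum_range_add_sum_Ico (fun j => j) hk
  rw [Finset.sum_range_id k, ← Nat.choose_two_right, Finset.sum_range_succ,
    Finset.sum_range_one] at h
  rw [show Finset.Icc 2 (k - 1) = Finset.Ico 2 k by ext; simp; omega]
  omega

theorem pow_sub_pow_ne_zero {q : ℕ} (hq : 1 < q) {j k : ℕ} (h : j < k) :
    (q : ℚ) ^ k - (q : ℚ) ^ j ≠ 0 :=
  (sub_pos.2 (pow_lt_pow_right₀ (by exact_mod_cast hq) h)).ne'

variable {F L : Type*} [Field F] [Field L] [Algebra F L] [Finite F] [Finite L] {k : ℕ}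
variable {V : Type*} [AddCommGroup V] [Module F V] [Module L V] [IsScalarTower F L V] [Finite V]

/-- The number of blocks through an `L`-independent pair for the blocks spanned by `L`-independent
families; it is zero if `k = m + 1`. -/
theorem card_blocks_pair_bot {q l m : ℕ} (hq : Nat.card F = q) (hl : finrank F L = l)
    (hm : finrank L V = m) (hm2 : 2 ≤ m) (hk : 3 ≤ k) (hkm : k ≤ m + 1) {y : Fin 2 → V}
    (hy : LinearIndependent L y) :
    (Nat.card {W : blocks F V ({⊥} : Set (Submodule L (Fin k → L))) // ∀ i, y i ∈ W.1} : ℚ) =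
      (q : ℚ) ^ ((l - 1) * (k.choose 2 - 1)) *
        ∏ j ∈ Finset.Icc 2 (k - 1), ((q : ℚ) ^ ((m - j) * l) - 1) / ((q : ℚ) ^ (k - j) - 1) := by
  have hq1 : 1 < q := hq ▸ Finite.one_lt_card
  have hl0 : 0 < l := hl ▸ finrank_pos
  have hQ : (Nat.card L : ℚ) = (q : ℚ) ^ l := by
    rw [← hq, ← hl, Module.natCard_eq_pow_finrank (K := F) (V := L)]
    push_cast
    rfl
  have hcount := (isAdmissible_bot F L k).card_blocks_pair (V := V) hy
  rw [card_frames_bot, hq, hm, hQ, prod_range_eq_mul_prod_Icc _ (by omega : 2 ≤ k),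
    prod_range_eq_mul_prod_Icc _ (by omega : 2 ≤ k)] at hcount
  simp only [pow_zero, pow_one] at hcount
  have e1 : ((q : ℚ) ^ l) ^ m - 1 ≠ 0 := by
    have := pow_sub_pow_ne_zero hq1 (Nat.mul_pos hl0 (by omega : 0 < m))
    rwa [pow_mul, pow_zero] at this
  have e2 : ((q : ℚ) ^ l) ^ m - (q : ℚ) ^ l ≠ 0 := by
    rw [← pow_mul]
    exact pow_sub_pow_ne_zero hq1 (lt_mul_of_one_lt_right hl0 (by omega))
  have e3 : (q : ℚ) ^ k - 1 ≠ 0 := by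
    simpa using pow_sub_pow_ne_zero hq1 (by omega : 0 < k)
  have e4 : (q : ℚ) ^ k - q ≠ 0 := by
    simpa using pow_sub_pow_ne_zero hq1 (by omega : 1 < k)
  have e5 : ∏ j ∈ Finset.Icc 2 (k - 1), ((q : ℚ) ^ k - (q : ℚ) ^ j) ≠ 0 :=
    Finset.prod_ne_zero_iff.2 fun j hj => pow_sub_pow_ne_zero hq1 (by
      rw [Finset.mem_Icc] at hj
      omega)
  have hc : (Nat.card {W : blocks F V ({⊥} : Set (Submodule L (Fin k → L))) //
      ∀ i, y i ∈ W.1} : ℚ) * ∏ j ∈ Finset.Icc 2 (k - 1), ((q : ℚ) ^ k - (q : ℚ) ^ j) =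
      ∏ j ∈ Finset.Icc 2 (k - 1), (((q : ℚ) ^ l) ^ m - ((q : ℚ) ^ l) ^ j) := by
    refine mul_left_cancel₀ (mul_ne_zero (mul_ne_zero e1 e2) (mul_ne_zero e3 e4)) ?_
    linear_combination hcount
  rw [← eq_div_iff e5, ← Finset.prod_div_distrib] at hc
  rw [hc, ← sum_Icc_two k (by omega), Finset.mul_sum, ← Finset.prod_pow_eq_pow_sum,
    ← Finset.prod_mul_distrib]
  refine Finset.prod_congr rfl fun j hj => ?_
  rw [Finset.mem_Icc] at hj
  have hq0 : (q : ℚ) ≠ 0 := by exact_mod_cast (by omega : q ≠ 0)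
  have e6 : (q : ℚ) ^ (k - j) - 1 ≠ 0 := by
    simpa using pow_sub_pow_ne_zero hq1 (by omega : 0 < k - j)
  have e7 : (q : ℚ) ^ k - (q : ℚ) ^ j = q ^ j * (q ^ (k - j) - 1) := by
    rw [mul_sub, mul_one, ← pow_add, Nat.add_sub_cancel' (by omega)]
  have e8 : ((q : ℚ) ^ l) ^ m - ((q : ℚ) ^ l) ^ j = q ^ j * (q ^ ((l - 1) * j) *
      (q ^ ((m - j) * l) - 1)) := by
    have h1 : j + (l - 1) * j = l * j := by
      obtain ⟨n, rfl⟩ := Nat.exists_eq_add_of_le' hl0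
      simp
      ring
    have h2 : l * j + (m - j) * l = l * m := by
      rw [mul_comm (m - j), ← mul_add, Nat.add_sub_cancel' (by omega)]
    rw [← mul_assoc, ← pow_add, h1, mul_sub, mul_one, ← pow_add, h2, pow_mul, pow_mul]
  rw [e7, e8, mul_div_mul_left _ _ (pow_ne_zero j hq0), mul_div_assoc]

/-- The number of blocks through an `L`-independent pair for the blocks attached to the
`Lˣ`-orbit of an `(r + 1)`-dimensional subspace `A` of `L`. -/
theorem card_blocks_pair_lineRelations {q l m r u : ℕ} (hq : Nat.card F = q)
    (hl : finrank F L = l) (hm : finrank L V = m) (hm2 : 2 ≤ m) (hk : 3 ≤ k) (hr : 2 ≤ r)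
    (hrk : r < k) (hu : 0 < u) {A : Submodule F L} (hA : finrank F A = r + 1)
    (hstab : Nat.card {c : Lˣ // c • A = A} + 1 = q ^ u) {y : Fin 2 → V}
    (hy : LinearIndependent L y) :
    (Nat.card {W : blocks F V (lineRelations k A) // ∀ i, y i ∈ W.1} : ℚ) =
      (((q : ℚ) ^ k - 1) * ((q : ℚ) ^ k - q) *
          ∏ j ∈ Finset.Icc 2 (k - 2), ((q : ℚ) ^ (m * l) - (q : ℚ) ^ (j * l))) /
        (((q : ℚ) ^ u - 1) * ∏ j ∈ Finset.Icc (r + 1) (k - 1), ((q : ℚ) ^ k - (q : ℚ) ^ j)) := by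
  have hq1 : 1 < q := hq ▸ Finite.one_lt_card
  have hl0 : 0 < l := hl ▸ finrank_pos
  have hQ : (Nat.card L : ℚ) = (q : ℚ) ^ l := by
    rw [← hq, ← hl, Module.natCard_eq_pow_finrank (K := F) (V := L)]
    push_cast
    rfl
  have hA0 : A ≠ ⊥ := by
    rintro rfl
    rw [finrank_bot] at hA
    omega
  have hs : (Nat.card {c : Lˣ // c • A = A} : ℚ) = (q : ℚ) ^ u - 1 := by
    rw [eq_sub_iff_add_eq]
    exact_mod_cast hstab
  have hcount := (isAdmissible_lineRelations (k := k) (by omega : 3 ≤ finrank F A)).card_blocks_pair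
    (V := V) hy
  have hframes := card_frames_lineRelations (k := k) V hA0
  have hsplit : ∏ j ∈ Finset.range k, ((q : ℚ) ^ k - (q : ℚ) ^ j) =
      (∏ j ∈ Finset.range (r + 1), ((q : ℚ) ^ k - (q : ℚ) ^ j)) *
        ∏ j ∈ Finset.Icc (r + 1) (k - 1), ((q : ℚ) ^ k - (q : ℚ) ^ j) := by
    rw [← Finset.prod_range_mul_prod_Ico _ (by omega : r + 1 ≤ k),
      show Finset.Icc (r + 1) (k - 1) = Finset.Ico (r + 1) k by ext; simp; omega]
  have hQj : ∀ j, ((q : ℚ) ^ l) ^ j = (q : ℚ) ^ (j * l) := fun j => by rw [← pow_mul, mul_comm]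
  rw [hs, hA, hq, hm, hQ, prod_range_eq_mul_prod_Icc _ (by omega : 2 ≤ k - 1),
    show k - 1 - 1 = k - 2 by omega, pow_zero, pow_one] at hframes
  rw [hq, hm, hQ, hsplit] at hcount
  simp only [hQj] at hcount hframes
  have e1 : (q : ℚ) ^ (m * l) - 1 ≠ 0 := by
    simpa using pow_sub_pow_ne_zero hq1 (Nat.mul_pos (by omega : 0 < m) hl0)
  have e2 : (q : ℚ) ^ (m * l) - (q : ℚ) ^ l ≠ 0 :=
    pow_sub_pow_ne_zero hq1 (lt_mul_of_one_lt_left hl0 (by omega))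
  have e3 : ∏ j ∈ Finset.range (r + 1), ((q : ℚ) ^ k - (q : ℚ) ^ j) ≠ 0 :=
    Finset.prod_ne_zero_iff.2 fun j hj => pow_sub_pow_ne_zero hq1 (by
      rw [Finset.mem_range] at hj
      omega)
  have e4 : ∏ j ∈ Finset.Icc (r + 1) (k - 1), ((q : ℚ) ^ k - (q : ℚ) ^ j) ≠ 0 :=
    Finset.prod_ne_zero_iff.2 fun j hj => pow_sub_pow_ne_zero hq1 (by
      rw [Finset.mem_Icc] at hj
      omega)
  have e5 : (q : ℚ) ^ u - 1 ≠ 0 := by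
    simpa using pow_sub_pow_ne_zero hq1 hu
  rw [eq_div_iff (mul_ne_zero e5 e4)]
  refine mul_left_cancel₀ (mul_ne_zero (mul_ne_zero e1 e2) e3) ?_
  linear_combination ((q : ℚ) ^ u - 1) * hcount +
    ((q : ℚ) ^ k - 1) * ((q : ℚ) ^ k - q) * hframes

end Values

end QDesign


open QDesign Pointwise in
theorem mainTheorem2
    {F : Type*} [Field F] [Finite F]
    {L : Type*} [Field L] [Algebra F L]
    {U : Type*} [AddCommGroup U] [Module F U]
    {V : Type*} [AddCommGroup V] [Module F V] [Module L V] [IsScalarTower F L V]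
    (q m l k : ℕ) (hq : Nat.card F = q)
    (hl : Module.finrank F L = l) (hm : Module.finrank L V = m)
    (hk : 3 ≤ k) (hkml : k ≤ min (m + 1) l)
    (H : Subgroup (U ≃ₗ[F] U)) (hH : QDesign.IsSingerCycle L H)
    (w : ℕ → ℕ → ℕ) (w₀ : ℕ)
    (hw : ∀ r ∈ Finset.Icc 2 (k - 1), ∀ u, u ∣ Nat.gcd (r + 1) l →
      w r u ≤ QDesign.orbitCount H (r + 1) u)
    (hw₀ : w₀ = 0 ∨ w₀ = 1)
    (K : Set ℕ) (lam : ℕ) (hlam : (lam : ℚ) = QDesign.lambdaValue q m l k w w₀)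
    (D : Multiset (Submodule F U))
    (hD : QDesign.IsPBD l K lam D) (hDH : QDesign.IsAutomorphismGroup H D) :
    ∃ A : Multiset (Submodule F V),
      QDesign.IsPBD (m * l) (K ∪ {k}) lam A ∧
      QDesign.IsAutomorphismGroup (QDesign.extGL F L V) A ∧
      (QDesign.IsSimple D → QDesign.IsSimple A) := by
  have hkm : k ≤ m + 1 := hkml.trans (min_le_left _ _)
  have hkl : k ≤ l := hkml.trans (min_le_right _ _)
  have hfL : Module.Finite F L := Module.finite_of_finrank_pos (by omega)
  have hfV : Module.Finite L V := Module.finite_of_finrank_pos (by omega)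
  have : Finite L := Module.finite_of_finite F
  have : Finite V := Module.finite_of_finite L
  have hq1 : 1 < q := hq ▸ Finite.one_lt_card
  obtain ⟨φ, rfl⟩ := hH.exists_eq_range
  have hS : ∀ r u, ∃ S : Finset (Set (Submodule F U)),
      (r ∈ Finset.Icc 2 (k - 1) → u ∣ Nat.gcd (r + 1) l → S.card = w r u) ∧
      ∀ O ∈ S, ∃ W : Submodule F U, Module.finrank F W = r + 1 ∧
        Nat.card (MulAction.stabilizer (scalarHom φ).range W) + 1 = Nat.card F ^ u ∧
        O = MulAction.orbit (scalarHom φ).range W := by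
    intro r u
    by_cases h : r ∈ Finset.Icc 2 (k - 1) ∧ u ∣ Nat.gcd (r + 1) l
    · obtain ⟨S, hS, hS'⟩ := exists_orbit_representatives _ (hw r h.1 u h.2)
      exact ⟨S, fun _ _ => hS, hS'⟩
    · exact ⟨∅, fun h1 h2 => absurd ⟨h1, h2⟩ h, by simp⟩
  choose S hScard hS using hS
  choose! rep hrep_rank hrep_stab hrep_orbit using hS
  -- One index for each chosen orbit of `(r + 1)`-subspaces with stabilizer of order `q ^ u - 1`.
  let J₀ : Finset (Σ _ : ℕ, Σ _ : ℕ, Set (Submodule F U)) :=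
    (Finset.Icc 2 (k - 1)).sigma fun r => (Nat.gcd (r + 1) l).divisors.sigma fun u => S r u
  have hJ₀ : ∀ j ∈ J₀, 2 ≤ j.1 ∧ j.1 < k ∧ j.2.2 ∈ S j.1 j.2.1 := by
    intro j hj
    simp only [J₀, Finset.mem_sigma, Finset.mem_Icc] at hj
    exact ⟨hj.1.1, by omega, hj.2.2⟩
  let sub : (Σ _ : ℕ, Σ _ : ℕ, Set (Submodule F U)) → Submodule F L :=
    fun j => (rep j.1 j.2.1 j.2.2).map φ.toLinearMap
  have hrank : ∀ j ∈ J₀, Module.finrank F (sub j) = j.1 + 1 := by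
    intro j hj
    rw [← hrep_rank _ _ _ (hJ₀ j hj).2.2]
    exact (Submodule.equivMapOfInjective φ.toLinearMap φ.injective _).finrank_eq.symm
  have hne : ∀ j ∈ J₀, sub j ≠ ⊥ := by
    intro j hj h
    have := hrank j hj
    rw [h, finrank_bot] at this
    omega
  have hstab : ∀ j ∈ J₀, Nat.card {c : Lˣ // c • sub j = sub j} + 1 = q ^ j.2.1 := by
    intro j hj
    rw [← hq, ← hrep_stab _ _ _ (hJ₀ j hj).2.2, card_stabilizer_scalarHom]
  -- `Fin w₀` indexes the last term of `lambdaValue`, which is used at most once.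
  let N : (Σ _ : ℕ, Σ _ : ℕ, Set (Submodule F U)) ⊕ Fin w₀ → Set (Submodule L (Fin k → L)) :=
    Sum.elim (fun j => lineRelations k (sub j)) fun _ => {⊥}
  have hsub : Subsingleton (Fin w₀) := by
    rcases hw₀ with rfl | rfl <;> infer_instance
  -- The indices of an orbit are determined by the subspace up to a scalar in `Lˣ`.
  have hdisj : ∀ i ∈ J₀, ∀ j ∈ J₀, i ≠ j →
      Disjoint (lineRelations k (sub i)) (lineRelations k (sub j)) := by
    intro i hi j hj hij
    by_contra h
    apply hij
    obtain ⟨c, hc⟩ := exists_smul_eq_of_not_disjoint_lineRelations (hne j hj) h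
    have h1 : j.2.2 = i.2.2 := by
      rw [hrep_orbit _ _ _ (hJ₀ j hj).2.2, hrep_orbit _ _ _ (hJ₀ i hi).2.2]
      exact orbit_eq_of_map_eq_smul hc
    have h2 : j.1 = i.1 := by
      have := hrank j hj
      rw [hc, finrank_units_smul, hrank i hi] at this
      omega
    have h3 : j.2.1 = i.2.1 := by
      apply Nat.pow_right_injective hq1
      change q ^ j.2.1 = q ^ i.2.1
      rw [← hstab j hj, ← hstab i hi, hc]
      refine congrArg (· + 1) (Nat.card_congr (Equiv.subtypeEquivRight fun d => ?_))
      rw [smul_smul, mul_comm, ← smul_smul, smul_left_cancel_iff]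
    exact Sigma.ext h2.symm (heq_of_eq (Sigma.ext h3.symm (heq_of_eq h1.symm)))
  refine exists_pbd_of_admissible (by omega) ?_ (J₀.disjSum Finset.univ) N ?_ ?_ ?_ hD hDH
  · rw [← Module.finrank_mul_finrank F L V, hl, hm, mul_comm]
  · intro j hj
    rcases j with j | j
    · refine isAdmissible_lineRelations ?_
      rw [Finset.inl_mem_disjSum] at hj
      rw [hrank j hj]
      have := (hJ₀ j hj).1
      omega
    · exact isAdmissible_bot F L k
  · intro i hi j hj hij
    rcases i with i | i <;> rcases j with j | j
    · rw [Finset.inl_mem_disjSum] at hi hj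
      exact hdisj i hi j hj fun h => hij (congrArg Sum.inl h)
    · rw [Finset.inl_mem_disjSum] at hi
      exact disjoint_lineRelations_bot (hne i hi)
    · rw [Finset.inl_mem_disjSum] at hj
      exact (disjoint_lineRelations_bot (hne j hj)).symm
    · exact absurd (congrArg Sum.inr (Subsingleton.elim i j)) hij
  · intro y hy
    have hcast : ((∑ j ∈ J₀.disjSum Finset.univ,
        Nat.card {W : blocks F V (N j) // ∀ i, y i ∈ W.1} : ℕ) : ℚ) = lam := by
      rw [hlam, lambdaValue, Finset.sum_disjSum, Nat.cast_add]
      congr 1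
      · rw [Finset.sum_sigma, Nat.cast_sum]
        refine Finset.sum_congr rfl fun r hr => ?_
        rw [Finset.sum_sigma, Nat.cast_sum]
        refine Finset.sum_congr rfl fun u hu => ?_
        rw [← hScard r u hr (Nat.dvd_of_mem_divisors hu), Nat.cast_sum, ← nsmul_eq_mul]
        refine Finset.sum_eq_card_nsmul fun O hO => ?_
        have hj : (⟨r, u, O⟩ : Σ _ : ℕ, Σ _ : ℕ, Set (Submodule F U)) ∈ J₀ :=
          Finset.mem_sigma.2 ⟨hr, Finset.mem_sigma.2 ⟨hu, hO⟩⟩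
        exact card_blocks_pair_lineRelations hq hl hm (by omega) hk (hJ₀ _ hj).1 (hJ₀ _ hj).2.1
          (Nat.pos_of_mem_divisors hu) (hrank _ hj) (hstab _ hj) hy
      · rw [mul_assoc, ← card_blocks_pair_bot hq hl hm (by omega) hk hkm hy]
        simp [N]
    exact_mod_cast hcast
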